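/- Let $(\Omega,\mathcal F,\mathbb{Q})$ be a probability space carrying a (Lévy) subordinator $Z=(Z_t)_{t\ge0}$, let $\kappa(\theta)=\ln E_{\mathbb Q}[e^{\theta Z_1}]$ be the cumulant generating function of $Z_1$, and let $\hat\kappa=\sup\{\theta\in\mathbb R:\kappa(\theta)<\infty\}\in[0,\infty]$. Assume $\hat\kappa>0$ and let $\rho\in\mathbb R$ with $\rho<\hat\kappa$, $\lambda>0$, $T>0$ and $\sigma_0^2>0$. Let $\sigma^2$ be the solution of \[ d\sigma_t^2=-\lambda\sigma_t^2\,dt+dZ_{\lambda t} \] with initial value $\sigma_0^2$, and put \[ I_t=\int_0^t\sigma_s^2\,ds,\qquad P_t=e^{\rho Z_{\lambda t}-\lambda t\kappa(\rho)},\qquad \alpha_{s,t}=\frac1\lambda\left(1-e^{-\lambda(t-s)}\right). \] (1) Let $f:[0,\infty)\to\mathbb R$ be continuous, let $c,d\ge0$ with $\max\{c,d\}>0$, and let $F_t=f(t)+\int_0^t(c\,\alpha_{s,t}+d)\,dZ_{\lambda s}$ for $t\ge0$. Then for every integer $\ell\ge0$ with $\ell\rho<\hat\kappa$ and every integer $k\ge0$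 such that $\kappa$ is $k$ times continuously differentiable in an open interval containing $0$, the random variable $P_T^\ell F_T^k$ is integrable and \[ E_{\mathbb Q}\left[P_T^\ell F_T^k\right]=e^{\lambda T(\kappa(\ell\rho)-\ell\kappa(\rho))}H_{\ell,k}, \] where the numbers $H_{\ell,h}$ are given by $H_{\ell,0}=1$ and, for $h=1,\ldots,k$, \[ H_{\ell,h}=f(T)H_{\ell,h-1}+\lambda\sum_{i=1}^h\binom{h-1}{i-1}H_{\ell,h-i}\,\kappa^{(i)}(\ell\rho)\int_0^T(c\,\alpha_{s,T}+d)^i\,ds. \] (2) The random variable $I_T$ is integrable. For every integer $\ell\ge0$ with $\ell\rho<\hat\kappa$ and every integer $k\ge0$ such that $\kappa$ is $k$ times continuously differentiable in an open interval containing $0$, the random variable $P_T^\ell(I_T-E_{\mathbb Q}[I_T])^k$ is integrable and \[ E_{\mathbb Q}\left[P_T^\ell\left(I_T-E_{\mathbb Q}[I_T]\right)^k\right]=e^{\lambda T(\kappa(\ell\rho)-\ell\kappa(\rho))}H_{\ell,k}, \] where now $H_{\ell,0}=1$ and, for $h=1,\ldots,k$, \[ \begin{aligned} H_{\ell,h}&=\left(-\lambda\kappa'(0)\int_0^T\alpha_{s,T}\,ds\right)H_{\ell,h-1}+\lambda\sum_{i=1}^h\binom{h-1}{i-1}H_{\ell,h-i}\,\kappa^{(i)}(\ell\rho)\int_0^T(\alpha_{s,T})^i\,ds\\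 &=\kappa'(0)\left(\alpha_{0,T}-T\right)H_{\ell,h-1}+\sum_{i=1}^h\frac1{\lambda^{i-1}}\binom{h-1}{i-1}H_{\ell,h-i}\,\kappa^{(i)}(\ell\rho)\left[T+\sum_{j=1}^i\frac1j\binom ij(-1)^j\alpha_{0,jT}\right]. \end{aligned} \] -/

import Mathlib

open MeasureTheory ProbabilityTheory Filter Topology Set
open scoped NNReal

namespace BNS

noncomputable section

/-- A real-valued Lévy process with time set `[0, ∞)` under the measure `Q`. -/
structure IsLevyProcess {Ω : Type*} [MeasurableSpace Ω] (Q : Measure Ω) (Z : ℝ≥0 → Ω → ℝ) :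
    Prop where
  measurable : ∀ t, Measurable (Z t)
  zero : ∀ᵐ ω ∂Q, Z 0 ω = 0
  indepIncrements : HasIndepIncrements Z Q
  stationaryIncrements : ∀ s t, IdentDistrib (fun ω => Z (s + t) ω - Z s ω) (Z t) Q Q
  stochContinuous : ∀ t, TendstoInMeasure Q Z (𝓝 t) (Z t)
  cadlag : ∀ᵐ ω ∂Q, ∀ t : ℝ≥0, ContinuousWithinAt (fun s => Z s ω) (Ici t) t ∧
    ∃ l : ℝ, Tendsto (fun s => Z s ω) (𝓝[<] t) (𝓝 l)

/-- A subordinator: a Lévy process with almost surely nondecreasing paths. -/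
structure IsSubordinator {Ω : Type*} [MeasurableSpace Ω] (Q : Measure Ω) (Z : ℝ≥0 → Ω → ℝ) :
    Prop extends IsLevyProcess Q Z where
  monotone : ∀ᵐ ω ∂Q, Monotone (fun t => Z t ω)

/-- The time-changed path `s ↦ Z_{λ s}(ω)`, `s ≥ 0` (equal to `Z_0(ω)` for `s < 0`). -/
def driver {Ω : Type*} (Z : ℝ≥0 → Ω → ℝ) (lam : ℝ) (ω : Ω) (s : ℝ) : ℝ :=
  Z (lam * s).toNNReal ω

open Classical in
/-- The Lebesgue–Stieltjes measure `dz` of a nondecreasing path `z`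
(zero by convention when the path is not nondecreasing). -/
def pathMeasure (z : ℝ → ℝ) : Measure ℝ :=
  if h : Monotone z then h.stieltjesFunction.measure else 0

/-- The pathwise Lebesgue–Stieltjes integral `∫_0^t g(s) dZ_{λ s}`, over `(0, t]`. -/
def integralDriver {Ω : Type*} (Z : ℝ≥0 → Ω → ℝ) (lam : ℝ) (g : ℝ → ℝ) (t : ℝ) (ω : Ω) : ℝ :=
  ∫ s in Ioc 0 t, g s ∂(pathMeasure (driver Z lam ω))

/-- The cumulant generating function `κ(θ) = ln E[exp(θ Z_1)]`. -/
def kappa {Ω : Type*} [MeasurableSpace Ω] (Q : Measure Ω) (Z : ℝ≥0 → Ω → ℝ) : ℝ → ℝ :=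
  cgf (Z 1) Q

/-- `κ̂ = sup {θ ∈ ℝ : κ(θ) < ∞}`, an extended real number. -/
def kappaHat {Ω : Type*} [MeasurableSpace Ω] (Q : Measure Ω) (Z : ℝ≥0 → Ω → ℝ) : EReal :=
  sSup ((fun θ : ℝ => (θ : EReal)) ''
    {θ : ℝ | Integrable (fun ω => Real.exp (θ * Z 1 ω)) Q})

/-- `α_{s,t} = (1 - e^{-λ (t - s)}) / λ`. -/
def alpha (lam s t : ℝ) : ℝ := 1 / lam * (1 - Real.exp (-lam * (t - s)))

/-- The integrated variance `I_t = ∫_0^t σ²_s ds` of a variance process `σ²`. -/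
def integratedVariance {Ω : Type*} (sigmaSq : ℝ≥0 → Ω → ℝ) (t : ℝ) (ω : Ω) : ℝ :=
  ∫ s in (0 : ℝ)..t, sigmaSq s.toNNReal ω

/-- `σ²` solves `dσ²_t = -λ σ²_t dt + dZ_{λ t}` with initial value `v0`, i.e. almost surely
`σ²_t = v0 - λ ∫_0^t σ²_s ds + Z_{λ t}` for all `t ≥ 0`. -/
def IsVarianceProcess {Ω : Type*} [MeasurableSpace Ω] (Q : Measure Ω) (Z : ℝ≥0 → Ω → ℝ)
    (lam v0 : ℝ) (sigmaSq : ℝ≥0 → Ω → ℝ) : Prop :=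
  ∀ᵐ ω ∂Q, ∀ t : ℝ≥0,
    IntervalIntegrable (fun s : ℝ => sigmaSq s.toNNReal ω) volume 0 t ∧
    sigmaSq t ω = v0 - lam * integratedVariance sigmaSq t ω + driver Z lam ω t

/-- `P_t = exp(ρ Z_{λ t} - λ t κ(ρ))`. -/
def P {Ω : Type*} [MeasurableSpace Ω] (Q : Measure Ω) (Z : ℝ≥0 → Ω → ℝ)
    (lam rho t : ℝ) (ω : Ω) : ℝ :=
  Real.exp (rho * driver Z lam ω t - lam * t * kappa Q Z rho)

/-- `F_t = f(t) + ∫_0^t (c α_{s,t} + d) dZ_{λ s}`. -/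
def F {Ω : Type*} (Z : ℝ≥0 → Ω → ℝ) (lam : ℝ) (f : ℝ → ℝ) (c d t : ℝ) (ω : Ω) : ℝ :=
  f t + integralDriver Z lam (fun s => c * alpha lam s t + d) t ω

/-- `g` is `k` times continuously differentiable in an open interval containing `0`. -/
def ContDiffNearZero (k : ℕ) (g : ℝ → ℝ) : Prop :=
  ∃ a b : ℝ, a < 0 ∧ 0 < b ∧ ContDiffOn ℝ k g (Ioo a b)

end

end BNS

/-! Both families of moments concern `X = a + ∫_0^T g(s) dZ_{λ s}` with deterministic `g`. With `θ =
ℓρ`, the weight `P_T^ℓ` is a constant times the density of `Q` tilted by `θ Z_{λT}`. Hence each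
expectation is the stated exponential prefactor times a moment of `X` under the tilted measure, and
`H` is that moment.

Independent stationary increments and Riemann sums give the exponential formula
`integral_exp_integralDriver`. The tilted cumulant generating function of `X` near `u = 0` is
therefore `u a + λ ∫_0^T (κ(θ + u g(s)) - κ(θ)) ds`; it is finite there because `θ < κ̂` strictly.
Its `i`-th derivative at `0` is `λ κ^{(i)}(θ) ∫ g^i`, plus `a` when `i = 1`. The recursion is the
Leibniz rule applied to `M' = K' M`, where `M` is the moment generating function and `K = log M`.

For the variance, solving the linear equation pathwise (`integral_eq_of_variance_equation`) gives
`I_T = σ_0² α_{0,T} + ∫ α_{s,T} dZ_{λ s}`, so the centred `I_T` has the same form with `g = α`. -/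

namespace BNS

/-! ### Riemann–Stieltjes sums and additive functions -/

/-- Left-endpoint Riemann sums of a continuous function against a locally finite measure
converge to its integral. -/
theorem tendsto_riemann_sum (μ : Measure ℝ) [IsLocallyFiniteMeasure μ] {g : ℝ → ℝ} {T : ℝ}
    (hT : 0 ≤ T) (hg : ContinuousOn g (Icc 0 T)) :
    Tendsto (fun n : ℕ => ∑ i ∈ Finset.range n,
      g (i * (T / n)) * μ.real (Ioc (i * (T / n)) ((i + 1) * (T / n)))) atTop
      (𝓝 (∫ s in Ioc 0 T, g s ∂μ)) := by
  have huc : UniformContinuousOn g (Icc 0 T) :=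
    isCompact_Icc.uniformContinuousOn_of_continuous hg
  rw [Metric.tendsto_atTop]
  intro ε hε
  set M := μ.real (Ioc 0 T) with hM
  have hM0 : 0 ≤ M := measureReal_nonneg
  -- The `+ 1` covers `M = 0` and makes the final inequality strict.
  obtain ⟨δ, hδ, hgδ⟩ := Metric.uniformContinuousOn_iff.1 huc (ε / (M + 1)) (by positivity)
  obtain ⟨N, hN⟩ := exists_nat_gt (T / δ)
  refine ⟨N + 1, fun n hn => ?_⟩
  have hn0 : (0 : ℝ) < n := by exact_mod_cast (by omega : 0 < n)
  have hmesh : T / n < δ := by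
    rw [div_lt_iff₀ hn0]
    rw [div_lt_iff₀ hδ] at hN
    have : (N : ℝ) ≤ n := by exact_mod_cast (by omega : N ≤ n)
    nlinarith
  set h := T / n with hh
  have hh0 : 0 ≤ h := by positivity
  have hnh : n * h = T := by rw [hh]; field_simp
  have hmem : ∀ i < n, Icc (i * h) ((i + 1) * h) ⊆ Icc 0 T := by
    intro i hi x hx
    have : ((i : ℝ) + 1) ≤ n := by exact_mod_cast hi
    refine ⟨le_trans (by positivity) hx.1, hx.2.trans ?_⟩
    rw [← hnh]; gcongr
  have hint : ∀ i < n, IntervalIntegrable g μ (i * h) ((i + 1) * h) := by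
    intro i hi
    have hle : i * h ≤ (i + 1) * h := by nlinarith
    refine ContinuousOn.intervalIntegrable ?_
    rw [uIcc_of_le hle]
    exact hg.mono (hmem i hi)
  have hsum : ∫ s in Ioc 0 T, g s ∂μ
      = ∑ i ∈ Finset.range n, ∫ s in (i * h)..((i + 1) * h), g s ∂μ := by
    have := intervalIntegral.sum_integral_adjacent_intervals (f := g) (μ := μ) (n := n)
      (a := fun i : ℕ => (i : ℝ) * h) (fun k hk => by simpa using hint k hk)
    rw [← intervalIntegral.integral_of_le hT]
    simp only [Nat.cast_add, Nat.cast_one, Nat.cast_zero, zero_mul, hnh] at this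
    exact this.symm
  have hmass : ∑ i ∈ Finset.range n, μ.real (Ioc (i * h) ((i + 1) * h)) = M := by
    have := intervalIntegral.sum_integral_adjacent_intervals (f := fun _ => (1 : ℝ)) (μ := μ)
      (n := n) (a := fun i : ℕ => (i : ℝ) * h) (fun k hk => intervalIntegrable_const)
    simp only [Nat.cast_add, Nat.cast_one, Nat.cast_zero, zero_mul, hnh] at this
    rw [intervalIntegral.integral_of_le hT] at this
    simp only [integral_const, smul_eq_mul, mul_one, measureReal_restrict_apply_univ] at this
    rw [hM, ← this]
    refine Finset.sum_congr rfl fun i _ => ?_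
    rw [intervalIntegral.integral_of_le (by nlinarith)]
    simp
  rw [hsum, Real.dist_eq, ← Finset.sum_sub_distrib]
  calc |∑ i ∈ Finset.range n, (g (i * h) * μ.real (Ioc (i * h) ((i + 1) * h))
        - ∫ s in (i * h)..((i + 1) * h), g s ∂μ)|
      ≤ ∑ i ∈ Finset.range n, |g (i * h) * μ.real (Ioc (i * h) ((i + 1) * h))
        - ∫ s in (i * h)..((i + 1) * h), g s ∂μ| := Finset.abs_sum_le_sum_abs _ _
    _ ≤ ∑ i ∈ Finset.range n, ε / (M + 1) * μ.real (Ioc (i * h) ((i + 1) * h)) := by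
        refine Finset.sum_le_sum fun i hi => ?_
        have hi := Finset.mem_range.1 hi
        have hle : i * h ≤ (i + 1) * h := by nlinarith
        have e : g (i * h) * μ.real (Ioc (i * h) ((i + 1) * h))
            = ∫ s in (i * h)..((i + 1) * h), g (i * h) ∂μ := by
          rw [intervalIntegral.integral_of_le hle]
          simp [mul_comm]
        rw [e, ← intervalIntegral.integral_sub intervalIntegrable_const (hint i hi),
          intervalIntegral.integral_of_le hle, ← Real.norm_eq_abs]
        refine norm_setIntegral_le_of_norm_le_const measure_Ioc_lt_top fun s hs => ?_
        rw [Real.norm_eq_abs, ← Real.dist_eq]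
        refine (hgδ _ (hmem i hi (left_mem_Icc.2 hle)) _ (hmem i hi (Ioc_subset_Icc_self hs))
          ?_).le
        rw [dist_comm, Real.dist_eq, abs_of_pos (by linarith [hs.1])]
        linarith [hs.2]
    _ = ε / (M + 1) * M := by rw [← Finset.mul_sum, hmass]
    _ < ε := by
        rw [div_mul_eq_mul_div, div_lt_iff₀ (by positivity)]
        nlinarith

instance isLocallyFiniteMeasure_pathMeasure (z : ℝ → ℝ) :
    IsLocallyFiniteMeasure (pathMeasure z) := by
  unfold pathMeasure
  split_ifs <;> infer_instance

/-- The Stieltjes function of a monotone path is its right limit; right-continuity identifies it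
with the path itself. -/
theorem pathMeasure_real_Ioc {z : ℝ → ℝ} (hz : Monotone z)
    (hr : ∀ x, ContinuousWithinAt z (Ici x) x) {a b : ℝ} (hab : a ≤ b) :
    (pathMeasure z).real (Ioc a b) = z b - z a := by
  have h (x : ℝ) : hz.stieltjesFunction x = z x := by
    rw [hz.stieltjesFunction_eq]
    exact rightLim_eq_of_tendsto
      ((hr x).mono Ioi_subset_Ici_self).tendsto
  rw [pathMeasure, dif_pos hz, measureReal_def, StieltjesFunction.measure_Ioc, h, h,
    ENNReal.toReal_ofReal (by linarith [hz hab])]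

/-- An additive monotone function on `[0, ∞)` is linear. -/
theorem eq_mul_of_additive_of_monotone {a : ℝ≥0 → ℝ} (hadd : ∀ s t, a (s + t) = a s + a t)
    (hmono : Monotone a) (t : ℝ≥0) : a t = t * a 1 := by
  have h0 : a 0 = 0 := by simpa using hadd 0 0
  have hn (n : ℕ) (t : ℝ≥0) : a (n * t) = n * a t := by
    induction n with
    | zero => simp [h0]
    | succ n ih => push_cast; rw [add_mul, add_mul, hadd, ih]; simp
  have hnat (n : ℕ) : a n = n * a 1 := by simpa using hn n 1
  have h1 : 0 ≤ a 1 := h0 ▸ hmono zero_le_one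
  -- Both `a (n t) = n a t` and `n t a 1` lie between `⌊n t⌋ a 1` and `(⌊n t⌋ + 1) a 1`, so they
  -- differ by at most `a 1`, whatever `n` is.
  have key (n : ℕ) : n * |a t - t * a 1| ≤ a 1 := by
    have hf := Nat.floor_le (zero_le (a := (n : ℝ≥0) * t))
    have hc := (Nat.lt_floor_add_one ((n : ℝ≥0) * t)).le
    have l := hmono hf
    have u := hmono hc
    rw [hnat, hn] at l
    rw [hn, hadd, hnat] at u
    have hf' : (⌊(n : ℝ≥0) * t⌋₊ : ℝ) ≤ n * t := by exact_mod_cast hf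
    have hc' : (n * t : ℝ) ≤ ⌊(n : ℝ≥0) * t⌋₊ + 1 := by exact_mod_cast hc
    rw [← abs_of_nonneg (Nat.cast_nonneg (α := ℝ) n), ← abs_mul, abs_le]
    constructor <;> nlinarith
  by_contra hne
  have hpos : 0 < |a t - t * a 1| := abs_pos.2 (sub_ne_zero.2 hne)
  obtain ⟨n, hn⟩ := exists_nat_gt (a 1 / |a t - t * a 1|)
  rw [div_lt_iff₀ hpos] at hn
  linarith [key n]

theorem eq_mul_of_additive_of_antitone {a : ℝ≥0 → ℝ} (hadd : ∀ s t, a (s + t) = a s + a t)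
    (hanti : Antitone a) (t : ℝ≥0) : a t = t * a 1 := by
  have := eq_mul_of_additive_of_monotone (a := fun t => -a t)
    (fun s t => by simp only [hadd]; ring) hanti.neg t
  linarith

/-- The Riemann sums of `∫_0^T g(s) dZ_{λ s}` over the uniform partition into `n` intervals. -/
noncomputable def driverSum {Ω : Type*} (Z : ℝ≥0 → Ω → ℝ) (lam : ℝ) (g : ℝ → ℝ) (T : ℝ)
    (n : ℕ) (ω : Ω) : ℝ :=
  ∑ i ∈ Finset.range n,
    g (i * (T / n)) * (driver Z lam ω ((i + 1) * (T / n)) - driver Z lam ω (i * (T / n)))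

theorem mul_div_mem_Icc {T : ℝ} (hT : 0 ≤ T) {i n : ℕ} (hi : i < n) :
    (i : ℝ) * (T / n) ∈ Icc 0 T := by
  have hn : (0 : ℝ) < n := by exact_mod_cast (by omega : 0 < n)
  have hin : (i : ℝ) ≤ n := by exact_mod_cast hi.le
  refine ⟨by positivity, ?_⟩
  rw [← mul_div_assoc, div_le_iff₀ hn, mul_comm T]
  gcongr

/-- The nonnegative increments telescope, which gives a dominating function independent of `n`. The
case `n = 0` must be excluded: the sum is then empty, while `K` may be negative. -/
theorem driverSum_le {Ω : Type*} {Z : ℝ≥0 → Ω → ℝ} {lam : ℝ} {g : ℝ → ℝ} {T K : ℝ}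
    (hT : 0 ≤ T) (hg : ∀ s ∈ Icc 0 T, g s ≤ K)
    {ω : Ω} (hm : Monotone (driver Z lam ω)) (h0 : driver Z lam ω 0 = 0) {n : ℕ} (hn : n ≠ 0) :
    driverSum Z lam g T n ω ≤ K * driver Z lam ω T := by
  have htel : ∑ i ∈ Finset.range n, (driver Z lam ω ((i + 1) * (T / n))
      - driver Z lam ω (i * (T / n))) = driver Z lam ω T := by
    have := Finset.sum_range_sub (fun i : ℕ => driver Z lam ω (i * (T / n))) n
    push_cast at this
    rw [this, zero_mul, h0, sub_zero]
    congr 1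
    field_simp
  rw [← htel, Finset.mul_sum]
  refine Finset.sum_le_sum fun i hi => ?_
  refine mul_le_mul_of_nonneg_right (hg _ (mul_div_mem_Icc hT (Finset.mem_range.1 hi))) ?_
  exact sub_nonneg.2 (hm (by gcongr; linarith))

/-! ### Exponential moments of a subordinator -/

section Subordinator

variable {Ω : Type*} [MeasurableSpace Ω] {Q : Measure Ω} {Z : ℝ≥0 → Ω → ℝ}

theorem IsSubordinator.ae_nonneg (hZ : IsSubordinator Q Z) :
    ∀ᵐ ω ∂Q, ∀ t, 0 ≤ Z t ω := by
  filter_upwards [hZ.zero, hZ.monotone] with ω h0 hm t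
  exact h0 ▸ hm (zero_le (a := t))

/-- If `X ≥ 0` almost surely, exponential integrability is inherited by smaller exponents. -/
theorem integrable_exp_mul_of_le_exponent [IsFiniteMeasure Q] {X Y : Ω → ℝ} {a b : ℝ}
    (hX : AEMeasurable X Q) (hX0 : 0 ≤ᵐ[Q] X) (hXY : X ≤ᵐ[Q] Y) (hab : a ≤ b)
    (hb : Integrable (fun ω => Real.exp (b * Y ω)) Q) :
    Integrable (fun ω => Real.exp (a * X ω)) Q := by
  refine Integrable.mono' (hb.add (integrable_const (1 : ℝ)))
    (hX.const_mul a).exp.aestronglyMeasurable ?_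
  filter_upwards [hX0, hXY] with ω h0 hle
  simp only [Pi.zero_apply] at h0
  rw [Real.norm_eq_abs, Real.abs_exp]
  simp only [Pi.add_apply]
  rcases le_total 0 b with hb0 | hb0
  · have : Real.exp (a * X ω) ≤ Real.exp (b * Y ω) := Real.exp_le_exp.2 (by nlinarith)
    linarith
  · have : Real.exp (a * X ω) ≤ 1 := Real.exp_le_one_iff.2 (by nlinarith)
    linarith [Real.exp_pos (b * Y ω)]

theorem IsSubordinator.integrable_exp_mul_one [IsFiniteMeasure Q] (hZ : IsSubordinator Q Z)
    {θ : ℝ} (hθ : (θ : EReal) < kappaHat Q Z) :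
    Integrable (fun ω => Real.exp (θ * Z 1 ω)) Q := by
  obtain ⟨_, ⟨b, hb, rfl⟩, hlt⟩ := lt_sSup_iff.1 hθ
  refine integrable_exp_mul_of_le_exponent (hZ.measurable 1).aemeasurable ?_ .rfl
    (EReal.coe_lt_coe_iff.1 hlt).le hb
  filter_upwards [hZ.ae_nonneg] with ω h using h 1

/-- At an integer time `n`, `Z_n` is a sum of `n` independent copies of `Z_1`; a general `t` is
dominated by an integer through monotonicity of paths. -/
theorem IsSubordinator.integrable_exp_mul [IsProbabilityMeasure Q] (hZ : IsSubordinator Q Z)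
    {θ : ℝ} (hθ : (θ : EReal) < kappaHat Q Z) (t : ℝ≥0) :
    Integrable (fun ω => Real.exp (θ * Z t ω)) Q := by
  have hind := hZ.indepIncrements.nat (t := fun n : ℕ => (n : ℝ≥0)) Nat.mono_cast
  have hnat (n : ℕ) : Integrable (fun ω => Real.exp (θ * Z n ω)) Q := by
    have hsum := hind.integrable_exp_mul_sum (t := θ) (s := Finset.range n)
      (fun i => (hZ.measurable _).sub (hZ.measurable _)) fun i _ => by
        have := (hZ.stationaryIncrements i 1).comp (measurable_const_mul θ).exp
        push_cast
        exact this.integrable_iff.2 (hZ.integrable_exp_mul_one hθ)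
    refine hsum.congr ?_
    filter_upwards [hZ.zero] with ω h0
    rw [Finset.sum_apply, Finset.sum_range_sub (fun i : ℕ => Z i ω) n]
    simp [h0]
  obtain ⟨n, hn⟩ := exists_nat_ge t
  refine integrable_exp_mul_of_le_exponent (hZ.measurable t).aemeasurable ?_ ?_ le_rfl (hnat n)
  · filter_upwards [hZ.ae_nonneg] with ω h using h t
  · filter_upwards [hZ.monotone] with ω h using h hn

/-- Independent stationary increments make the cumulant generating function additive in `t`.
Monotone paths make it monotone in `t`, increasing or decreasing with the sign of `θ`, so additivity
forces linearity. -/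
theorem IsSubordinator.cgf_eq [IsProbabilityMeasure Q] (hZ : IsSubordinator Q Z)
    {θ : ℝ} (hθ : (θ : EReal) < kappaHat Q Z) (t : ℝ≥0) :
    cgf (Z t) Q θ = t * kappa Q Z θ := by
  have hint := hZ.integrable_exp_mul hθ
  have hadd (s t : ℝ≥0) : cgf (Z (s + t)) Q θ = cgf (Z s) Q θ + cgf (Z t) Q θ := by
    have hid := hZ.stationaryIncrements s t
    have hi : Integrable (fun ω => Real.exp (θ * (Z (s + t) - Z s) ω)) Q :=
      (hid.comp (measurable_const_mul θ).exp).integrable_iff.2 (hint t)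
    have := (hZ.indepIncrements.indepFun_eval_sub (zero_le (a := s))
      (le_self_add : s ≤ s + t) hZ.zero).cgf_add (hint s) hi
    rw [add_sub_cancel] at this
    rw [this, cgf, cgf, cgf]
    congr 2
    exact congrFun (mgf_congr_identDistrib hid) θ
  have hpos (t : ℝ≥0) : 0 < mgf (Z t) Q θ := mgf_pos (hint t)
  rcases le_total 0 θ with h0 | h0
  · refine eq_mul_of_additive_of_monotone (a := fun t => cgf (Z t) Q θ) hadd (fun s t hst => ?_) t
    refine Real.log_le_log (hpos s) (mgf_mono_of_nonneg ?_ h0 (hint t))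
    filter_upwards [hZ.monotone] with ω h using h hst
  · refine eq_mul_of_additive_of_antitone (a := fun t => cgf (Z t) Q θ) hadd (fun s t hst => ?_) t
    refine Real.log_le_log (hpos t) (mgf_anti_of_nonpos ?_ h0 (hint s))
    filter_upwards [hZ.monotone] with ω h using h hst

theorem IsSubordinator.mgf_eq [IsProbabilityMeasure Q] (hZ : IsSubordinator Q Z)
    {θ : ℝ} (hθ : (θ : EReal) < kappaHat Q Z) (t : ℝ≥0) :
    mgf (Z t) Q θ = Real.exp (t * kappa Q Z θ) := by
  rw [← hZ.cgf_eq hθ, exp_cgf (hZ.integrable_exp_mul hθ t)]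

/-- Lying strictly below `κ̂` is an open condition; this is the source of analyticity of `κ`. -/
theorem IsSubordinator.mem_interior_integrableExpSet [IsFiniteMeasure Q]
    (hZ : IsSubordinator Q Z) {θ : ℝ} (hθ : (θ : EReal) < kappaHat Q Z) :
    θ ∈ interior (integrableExpSet (Z 1) Q) := by
  rw [mem_interior_iff_mem_nhds]
  have : ∀ᶠ x : ℝ in 𝓝 θ, (x : EReal) < kappaHat Q Z :=
    continuous_coe_real_ereal.continuousAt.eventually_lt continuousAt_const hθ
  filter_upwards [this] with x hx using hZ.integrable_exp_mul_one hx

theorem IsSubordinator.analyticAt_kappa [IsFiniteMeasure Q]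
    (hZ : IsSubordinator Q Z) {θ : ℝ} (hθ : (θ : EReal) < kappaHat Q Z) :
    AnalyticAt ℝ (kappa Q Z) θ :=
  analyticAt_cgf (hZ.mem_interior_integrableExpSet hθ)

/-! ### Integrals of deterministic functions against the driver -/

variable {lam : ℝ}

/-- Almost every driver path is nondecreasing, right-continuous and starts at `0`. -/
theorem IsSubordinator.ae_driver (hZ : IsSubordinator Q Z) (hlam : 0 ≤ lam) :
    ∀ᵐ ω ∂Q, Monotone (driver Z lam ω) ∧
      (∀ x, ContinuousWithinAt (driver Z lam ω) (Ici x) x) ∧ driver Z lam ω 0 = 0 := by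
  filter_upwards [hZ.zero, hZ.monotone, hZ.cadlag] with ω h0 hm hc
  have hmono : Monotone (fun s : ℝ => (lam * s).toNNReal) := fun s t hst =>
    Real.toNNReal_mono (mul_le_mul_of_nonneg_left hst hlam)
  refine ⟨fun s t hst => hm (hmono hst), fun x => ?_, by simp [driver, h0]⟩
  refine (hc (lam * x).toNNReal).1.comp (t := Ici (lam * x).toNNReal)
    (f := fun s : ℝ => (lam * s).toNNReal) ?_ fun s hs => hmono hs
  exact (by fun_prop : Continuous fun s : ℝ => (lam * s).toNNReal).continuousWithinAt

theorem IsSubordinator.ae_tendsto_driverSum (hZ : IsSubordinator Q Z) (hlam : 0 ≤ lam)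
    {g : ℝ → ℝ} {T : ℝ} (hT : 0 ≤ T) (hg : ContinuousOn g (Icc 0 T)) :
    ∀ᵐ ω ∂Q, Tendsto (fun n => driverSum Z lam g T n ω) atTop
      (𝓝 (integralDriver Z lam g T ω)) := by
  filter_upwards [hZ.ae_driver hlam] with ω ⟨hm, hr, _⟩
  refine (tendsto_riemann_sum (pathMeasure (driver Z lam ω)) hT hg).congr fun n => ?_
  refine Finset.sum_congr rfl fun i _ => ?_
  rw [pathMeasure_real_Ioc hm hr (by gcongr; linarith)]

theorem IsSubordinator.measurable_driverSum (hZ : IsSubordinator Q Z) (g : ℝ → ℝ) (T : ℝ)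
    (n : ℕ) : Measurable (driverSum Z lam g T n) := by
  have (x : ℝ) : Measurable fun ω => driver Z lam ω x := hZ.measurable _
  unfold driverSum
  fun_prop

theorem IsSubordinator.aemeasurable_integralDriver (hZ : IsSubordinator Q Z) (hlam : 0 ≤ lam)
    {g : ℝ → ℝ} {T : ℝ} (hT : 0 ≤ T) (hg : ContinuousOn g (Icc 0 T)) :
    AEMeasurable (integralDriver Z lam g T) Q :=
  aemeasurable_of_tendsto_metrizable_ae atTop
    (fun n => (hZ.measurable_driverSum g T n).aemeasurable) (hZ.ae_tendsto_driverSum hlam hT hg)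

/-- Independence factors the expectation and stationarity evaluates each factor. Writing the mesh as
a Lebesgue measure makes the exponent a Riemann sum to which `tendsto_riemann_sum` applies again. -/
theorem IsSubordinator.integral_exp_driverSum [IsProbabilityMeasure Q] (hZ : IsSubordinator Q Z)
    (hlam : 0 ≤ lam) {g : ℝ → ℝ} {T : ℝ} (hT : 0 ≤ T)
    (hg : ∀ s ∈ Icc 0 T, (g s : EReal) < kappaHat Q Z) (n : ℕ) :
    ∫ ω, Real.exp (driverSum Z lam g T n ω) ∂Q =
      Real.exp (lam * ∑ i ∈ Finset.range n, kappa Q Z (g (i * (T / n))) *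
        volume.real (Ioc (i * (T / n)) ((i + 1) * (T / n)))) := by
  set δ : ℝ≥0 := (lam * (T / n)).toNNReal with hδ
  have hδ' : (δ : ℝ) = lam * (T / n) := Real.coe_toNNReal _ (by positivity)
  have hgrid (i : ℕ) : (lam * (i * (T / n))).toNNReal = i * δ := by
    rw [hδ, mul_left_comm, Real.toNNReal_mul (Nat.cast_nonneg _), Real.toNNReal_natCast]
  have hind := hZ.indepIncrements.nat (t := fun i : ℕ => (i : ℝ≥0) * δ)
    fun i j hij => mul_le_mul_left (Nat.cast_le.2 hij) δ
  have hind' := hind.comp (fun i x => g (i * (T / n)) * x) fun i => measurable_const_mul _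
  have hmgf := hind'.mgf_sum (t := 1)
    (fun i => (measurable_const_mul _).comp ((hZ.measurable _).sub (hZ.measurable _)))
    (Finset.range n)
  have hL : ∫ ω, Real.exp (driverSum Z lam g T n ω) ∂Q = mgf (∑ i ∈ Finset.range n,
      (fun x => g (i * (T / n)) * x) ∘
        fun ω => Z (((i + 1 : ℕ) : ℝ≥0) * δ) ω - Z ((i : ℝ≥0) * δ) ω) Q 1 := by
    refine integral_congr_ae (.of_forall fun ω => ?_)
    simp only [driverSum, driver, one_mul, Finset.sum_apply, Function.comp]
    congr 1
    refine Finset.sum_congr rfl fun i _ => ?_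
    rw [← hgrid i, ← hgrid (i + 1)]
    push_cast
    rfl
  rw [hL, hmgf, Finset.mul_sum, Real.exp_sum]
  refine Finset.prod_congr rfl fun i hi => ?_
  have hgi := hg _ (mul_div_mem_Icc hT (Finset.mem_range.1 hi))
  have e := hZ.stationaryIncrements (i * δ) δ
  have hvol : volume.real (Ioc (i * (T / n)) ((i + 1) * (T / n))) = T / n := by
    rw [measureReal_def, Real.volume_Ioc, ENNReal.toReal_ofReal] <;> ring_nf
    positivity
  calc mgf ((fun x => g (i * (T / n)) * x) ∘
        fun ω => Z (((i + 1 : ℕ) : ℝ≥0) * δ) ω - Z ((i : ℝ≥0) * δ) ω) Q 1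
      = mgf (fun ω => Z (i * δ + δ) ω - Z (i * δ) ω) Q (g (i * (T / n))) := by
        rw [← mul_one (g (i * (T / n))), ← mgf_const_mul]
        push_cast
        simp only [add_mul, one_mul, mul_one]
        rfl
    _ = Real.exp (δ * kappa Q Z (g (i * (T / n)))) := by
        rw [mgf_congr_identDistrib e, hZ.mgf_eq hgi]
    _ = _ := by rw [hvol, hδ']; ring_nf

/-- The exponential formula `E[exp(∫_0^T g(s) dZ_{λ s})] = exp(λ ∫_0^T κ(g(s)) ds)`. -/
theorem IsSubordinator.integral_exp_integralDriver [IsProbabilityMeasure Q]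
    (hZ : IsSubordinator Q Z) (hlam : 0 ≤ lam) {g : ℝ → ℝ} {T K : ℝ} (hT : 0 ≤ T)
    (hg : ContinuousOn g (Icc 0 T)) (hK : (K : EReal) < kappaHat Q Z)
    (hgK : ∀ s ∈ Icc 0 T, g s ≤ K) :
    Integrable (fun ω => Real.exp (integralDriver Z lam g T ω)) Q ∧
    ∫ ω, Real.exp (integralDriver Z lam g T ω) ∂Q =
      Real.exp (lam * ∫ s in (0 : ℝ)..T, kappa Q Z (g s)) := by
  have hgK' : ∀ s ∈ Icc 0 T, (g s : EReal) < kappaHat Q Z := fun s hs =>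
    (EReal.coe_le_coe_iff.2 (hgK s hs)).trans_lt hK
  have hlim := hZ.ae_tendsto_driverSum hlam hT hg
  have hbd : Integrable (fun ω => Real.exp (K * driver Z lam ω T)) Q :=
    hZ.integrable_exp_mul hK _
  have hdom (n : ℕ) (hn : n ≠ 0) : ∀ᵐ ω ∂Q,
      ‖Real.exp (driverSum Z lam g T n ω)‖ ≤ Real.exp (K * driver Z lam ω T) := by
    filter_upwards [hZ.ae_driver hlam] with ω ⟨hm, _, h0⟩
    rw [Real.norm_eq_abs, Real.abs_exp, Real.exp_le_exp]
    exact driverSum_le hT hgK hm h0 hn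
  have hexp : ∀ᵐ ω ∂Q, Tendsto (fun n => Real.exp (driverSum Z lam g T n ω)) atTop
      (𝓝 (Real.exp (integralDriver Z lam g T ω))) := by
    filter_upwards [hlim] with ω h using (Real.continuous_exp.tendsto _).comp h
  constructor
  · refine hbd.mono' (hZ.aemeasurable_integralDriver hlam hT hg).exp.aestronglyMeasurable ?_
    -- The index is shifted because the domination needs a nonempty partition.
    have := ae_all_iff.2 fun n : ℕ => hdom (n + 1) n.succ_ne_zero
    filter_upwards [this, hexp] with ω h hl
    exact le_of_tendsto (hl.norm.comp (tendsto_add_atTop_nat 1)) (.of_forall h)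
  · have h1 := tendsto_integral_filter_of_dominated_convergence _
      (.of_forall fun n => (hZ.measurable_driverSum g T n).exp.aestronglyMeasurable)
      ((eventually_ne_atTop 0).mono hdom) hbd hexp
    simp only [hZ.integral_exp_driverSum hlam hT hgK'] at h1
    refine tendsto_nhds_unique h1 ?_
    have hκ : ContinuousOn (fun s => kappa Q Z (g s)) (Icc 0 T) := fun s hs =>
      (hZ.analyticAt_kappa (hgK' s hs)).continuousAt.comp_continuousWithinAt (hg s hs)
    rw [intervalIntegral.integral_of_le hT]
    exact (Real.continuous_exp.tendsto _).comp ((tendsto_riemann_sum volume hT hκ).const_mul lam)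

/-- This absorbs a tilt by `θ Z_{λT}` into the integrand: the constant `θ` integrates to `θ Z_{λT}`
because the path starts at `0`. -/
theorem IsSubordinator.ae_integralDriver_add_mul (hZ : IsSubordinator Q Z) (hlam : 0 ≤ lam)
    {g : ℝ → ℝ} {T : ℝ} (hT : 0 ≤ T) (hg : Continuous g) (θ u : ℝ) :
    ∀ᵐ ω ∂Q, integralDriver Z lam (fun s => θ + u * g s) T ω =
      θ * driver Z lam ω T + u * integralDriver Z lam g T ω := by
  filter_upwards [hZ.ae_driver hlam] with ω ⟨hm, hr, h0⟩
  have hgi : Integrable g ((pathMeasure (driver Z lam ω)).restrict (Ioc 0 T)) :=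
    (hg.continuousOn.integrableOn_Icc (a := 0) (b := T)).mono_set Ioc_subset_Icc_self
  rw [integralDriver, integral_add (integrableOn_const measure_Ioc_lt_top.ne).integrable (hgi.const_mul u),
    integral_const_mul, setIntegral_const, pathMeasure_real_Ioc hm hr hT, h0, sub_zero,
    smul_eq_mul, mul_comm θ, integralDriver]

end Subordinator

/-! ### Cumulants and differentiation under the integral -/

/-- The recursion expressing moments through cumulants. -/
theorem integral_pow_eq_sum_cumulants {Ω : Type*} [MeasurableSpace Ω] {ν : Measure Ω} [NeZero ν]
    {X : Ω → ℝ} (h0 : 0 ∈ interior (integrableExpSet X ν)) {h : ℕ} (hh : 1 ≤ h) :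
    ∫ ω, X ω ^ h ∂ν = ∑ i ∈ Finset.Icc 1 h, ((h - 1).choose (i - 1) : ℝ) *
      (∫ ω, X ω ^ (h - i) ∂ν) * iteratedDeriv i (cgf X ν) 0 := by
  obtain ⟨n, rfl⟩ : ∃ n, h = n + 1 := ⟨h - 1, by omega⟩
  have hmom (m : ℕ) : iteratedDeriv m (mgf X ν) 0 = ∫ ω, X ω ^ m ∂ν := by
    rw [iteratedDeriv_mgf_zero h0]; rfl
  -- The relation `M' = K' M` is needed on a neighbourhood of `0`, since `n` further derivatives are
  -- taken.
  have hev : deriv (mgf X ν) =ᶠ[𝓝 0] deriv (cgf X ν) * mgf X ν := by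
    filter_upwards [isOpen_interior.mem_nhds h0] with u hu
    have hpos : 0 < mgf X ν u := mgf_pos' NeZero.out (integrable_of_mem_integrableExpSet (interior_subset hu))
    rw [Pi.mul_apply, deriv_cgf hu, deriv_mgf hu, div_mul_cancel₀ _ hpos.ne']
  have hl := iteratedDeriv_mul (n := n) (analyticAt_cgf h0).deriv.contDiffAt
    (analyticAt_mgf h0).contDiffAt
  rw [← hmom, iteratedDeriv_succ', (hev.iteratedDeriv n).eq_of_nhds, hl,
    ← Finset.Ico_add_one_right_eq_Icc, Finset.sum_Ico_eq_sum_range]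
  refine Finset.sum_congr (by simp) fun i _ => ?_
  rw [hmom, ← iteratedDeriv_succ', add_comm 1 i]
  simp only [Nat.add_sub_cancel, Nat.add_sub_add_right]
  ring

/-- Differentiation under the integral sign of `u ↦ ∫_0^T ψ(θ + u g(s)) ds` at `u = 0`. -/
theorem iteratedDeriv_integral_comp_add_mul {ψ g : ℝ → ℝ} {θ T : ℝ} (hψ : AnalyticAt ℝ ψ θ)
    (hg : Continuous g) (hT : 0 ≤ T) (n : ℕ) :
    iteratedDeriv n (fun u => ∫ s in (0 : ℝ)..T, ψ (θ + u * g s)) 0 =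
      iteratedDeriv n ψ θ * ∫ s in (0 : ℝ)..T, g s ^ n := by
  obtain ⟨r, hr, hball⟩ := hψ.exists_ball_analyticOnNhd
  obtain ⟨M', hM'⟩ := isCompact_Icc.exists_bound_of_continuousOn (hg.continuousOn (s := Icc 0 T))
  set M := max M' 1 with hMdef
  have hM0 : 0 < M := lt_of_lt_of_le one_pos (le_max_right _ _)
  have hM : ∀ s ∈ Icc 0 T, |g s| ≤ M := fun s hs => (hM' s hs).trans (le_max_left _ _)
  -- This radius keeps `θ + u g(s)` in a compact ball where `ψ` is analytic, so every derivative of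
  -- `ψ` is bounded there.
  have hmem : ∀ u ∈ Metric.ball (0 : ℝ) (r / 2 / M), ∀ s ∈ Icc 0 T,
      θ + u * g s ∈ Metric.closedBall θ (r / 2) := by
    intro u hu s hs
    rw [mem_ball_zero_iff, Real.norm_eq_abs, lt_div_iff₀ hM0] at hu
    rw [Metric.mem_closedBall, Real.dist_eq, add_sub_cancel_left, abs_mul]
    have := mul_le_mul_of_nonneg_left (hM s hs) (abs_nonneg u)
    linarith
  have hsub : Metric.closedBall θ (r / 2) ⊆ Metric.ball θ r :=
    Metric.closedBall_subset_ball (by linarith)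
  have han (m : ℕ) : ∀ x ∈ Metric.closedBall θ (r / 2), AnalyticAt ℝ (iteratedDeriv m ψ) x := by
    rw [iteratedDeriv_eq_iterate]
    exact fun x hx => AnalyticOnNhd.iterated_deriv hball m x (hsub hx)
  have hcont (m : ℕ) : ∀ u ∈ Metric.ball (0 : ℝ) (r / 2 / M),
      ContinuousOn (fun s => iteratedDeriv m ψ (θ + u * g s) * g s ^ m) (Icc 0 T) := by
    intro u hu s hs
    refine ContinuousWithinAt.mul ?_ (hg.pow m).continuousWithinAt
    exact ContinuousAt.comp_continuousWithinAt (f := fun s => θ + u * g s)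
      (han m _ (hmem u hu s hs)).continuousAt
      (by fun_prop : Continuous fun s => θ + u * g s).continuousWithinAt
  have hii (m : ℕ) : ∀ u ∈ Metric.ball (0 : ℝ) (r / 2 / M), IntervalIntegrable
      (fun s => iteratedDeriv m ψ (θ + u * g s) * g s ^ m) volume 0 T := fun u hu =>
    ContinuousOn.intervalIntegrable (by rw [uIcc_of_le hT]; exact hcont m u hu)
  have hIoc : uIoc 0 T ⊆ Icc 0 T := by rw [uIoc_of_le hT]; exact Ioc_subset_Icc_self
  have hderiv (m : ℕ) : ∀ u ∈ Metric.ball (0 : ℝ) (r / 2 / M),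
      HasDerivAt (fun u => ∫ s in (0 : ℝ)..T, iteratedDeriv m ψ (θ + u * g s) * g s ^ m)
        (∫ s in (0 : ℝ)..T, iteratedDeriv (m + 1) ψ (θ + u * g s) * g s ^ (m + 1)) u := by
    intro u hu
    have hnhds := Metric.isOpen_ball.mem_nhds hu
    obtain ⟨C, hC⟩ := (isCompact_closedBall θ (r / 2)).exists_bound_of_continuousOn
      fun x hx => (han (m + 1) x hx).continuousAt.continuousWithinAt
    refine (intervalIntegral.hasDerivAt_integral_of_dominated_loc_of_deriv_le
      (F := fun u s => iteratedDeriv m ψ (θ + u * g s) * g s ^ m)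
      (F' := fun u s => iteratedDeriv (m + 1) ψ (θ + u * g s) * g s ^ (m + 1))
      (bound := fun _ => C * M ^ (m + 1)) hnhds ?_ (hii m u hu)
      (hii (m + 1) u hu).def'.aestronglyMeasurable ?_ intervalIntegrable_const ?_).2
    · filter_upwards [hnhds] with v hv using (hii m v hv).def'.aestronglyMeasurable
    · refine .of_forall fun s hs v hv => ?_
      rw [norm_mul, norm_pow, Real.norm_eq_abs (g s)]
      have hCs := hC _ (hmem v hv s (hIoc hs))
      have := hM s (hIoc hs)
      have hC0 : 0 ≤ C := (norm_nonneg _).trans hCs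
      gcongr
    · refine .of_forall fun s hs v hv => ?_
      have h1 := (han m _ (hmem v hv s (hIoc hs))).differentiableAt.hasDerivAt
      rw [← iteratedDeriv_succ] at h1
      have h2 : HasDerivAt (fun v => θ + v * g s) (g s) v := by
        simpa using ((hasDerivAt_id v).mul_const (g s)).const_add θ
      have h3 := (h1.comp v h2).mul_const (g s ^ m)
      rw [mul_assoc, ← pow_succ'] at h3
      exact h3
  -- The formula is proved on the whole ball, not only at `0`, so that the induction can
  -- differentiate it.
  have hmain (m : ℕ) : ∀ u ∈ Metric.ball (0 : ℝ) (r / 2 / M),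
      iteratedDeriv m (fun u => ∫ s in (0 : ℝ)..T, ψ (θ + u * g s)) u =
        ∫ s in (0 : ℝ)..T, iteratedDeriv m ψ (θ + u * g s) * g s ^ m := by
    induction m with
    | zero => intro u _; simp
    | succ m ih =>
      intro u hu
      rw [iteratedDeriv_succ, ← (hderiv m u hu).deriv]
      refine EventuallyEq.deriv_eq ?_
      filter_upwards [Metric.isOpen_ball.mem_nhds hu] with v hv using ih v hv
  rw [hmain n 0 (Metric.mem_ball_self (by positivity))]
  simp

/-! ### Moments under the tilted measure -/

theorem P_pow {Ω : Type*} [MeasurableSpace Ω] (Q : Measure Ω) (Z : ℝ≥0 → Ω → ℝ) (lam rho t : ℝ)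
    (l : ℕ) (ω : Ω) :
    P Q Z lam rho t ω ^ l = Real.exp (-(l * (lam * t * kappa Q Z rho))) *
      Real.exp (l * rho * driver Z lam ω t) := by
  rw [P, ← Real.exp_nat_mul, ← Real.exp_add]
  ring_nf

section TiltedMoments

variable {Ω : Type*} [MeasurableSpace Ω] {Q : Measure Ω} [IsProbabilityMeasure Q]
  {Z : ℝ≥0 → Ω → ℝ} {lam T θ : ℝ} {g : ℝ → ℝ}

theorem IsSubordinator.integrable_exp_mul_driver (hZ : IsSubordinator Q Z)
    (hθ : (θ : EReal) < kappaHat Q Z) (lam T : ℝ) :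
    Integrable (fun ω => Real.exp (θ * driver Z lam ω T)) Q :=
  hZ.integrable_exp_mul hθ _

theorem IsSubordinator.integral_exp_mul_driver (hZ : IsSubordinator Q Z) (hlam : 0 ≤ lam)
    (hT : 0 ≤ T) (hθ : (θ : EReal) < kappaHat Q Z) :
    ∫ ω, Real.exp (θ * driver Z lam ω T) ∂Q = Real.exp (lam * T * kappa Q Z θ) := by
  have := hZ.mgf_eq hθ (lam * T).toNNReal
  rwa [Real.coe_toNNReal _ (by positivity)] at this

/-- Near `0`, the moment generating function of `a + ∫_0^T g(s) dZ_{λ s}` under the measure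
exponentially tilted by `θ Z_{λ T}`. -/
theorem IsSubordinator.eventually_mgf_tilted (hZ : IsSubordinator Q Z) (hlam : 0 ≤ lam)
    (hT : 0 ≤ T) (hg : Continuous g) (hθ : (θ : EReal) < kappaHat Q Z) (a : ℝ) :
    ∀ᶠ u in 𝓝 (0 : ℝ), u ∈ integrableExpSet (fun ω => a + integralDriver Z lam g T ω)
        (Q.tilted fun ω => θ * driver Z lam ω T) ∧
      mgf (fun ω => a + integralDriver Z lam g T ω)
        (Q.tilted fun ω => θ * driver Z lam ω T) u =
      Real.exp (u * a + lam * (∫ s in (0 : ℝ)..T, kappa Q Z (θ + u * g s))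
        - lam * T * kappa Q Z θ) := by
  obtain ⟨M, hM⟩ := isCompact_Icc.exists_bound_of_continuousOn (hg.continuousOn (s := Icc 0 T))
  -- For small `u`, the number `θ + |u| M` is still below `κ̂` and bounds the integrand `θ + u g`,
  -- as the exponential formula requires.
  have hlt : ∀ᶠ u : ℝ in 𝓝 0, ((θ + |u| * M : ℝ) : EReal) < kappaHat Q Z := by
    refine ContinuousAt.eventually_lt ?_ continuousAt_const (by simpa using hθ)
    exact (continuous_coe_real_ereal.comp (by fun_prop)).continuousAt
  filter_upwards [hlt] with u hu
  obtain ⟨hi, he⟩ := hZ.integral_exp_integralDriver hlam hT (g := fun s => θ + u * g s)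
    (by fun_prop) hu fun s hs => by
      have h1 := le_abs_self (u * g s)
      have h2 := mul_le_mul_of_nonneg_left (hM s hs) (abs_nonneg u)
      rw [Real.norm_eq_abs, ← abs_mul] at h2
      linarith
  have hae : (fun ω => Real.exp (u * a) *
      Real.exp (integralDriver Z lam (fun s => θ + u * g s) T ω)) =ᵐ[Q]
      fun ω => Real.exp (θ * driver Z lam ω T) •
        Real.exp (u * (a + integralDriver Z lam g T ω)) := by
    filter_upwards [hZ.ae_integralDriver_add_mul hlam hT hg θ u] with ω h
    rw [h, smul_eq_mul, ← Real.exp_add, ← Real.exp_add]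
    ring_nf
  have hexp := hZ.integral_exp_mul_driver hlam hT hθ
  constructor
  · exact (integrable_tilted_iff (hZ.integrable_exp_mul_driver hθ lam T) _).2
      ((hi.const_mul _).congr hae)
  · rw [mgf, integral_tilted]
    simp_rw [div_eq_inv_mul, mul_smul]
    rw [integral_smul, ← integral_congr_ae hae, integral_const_mul, he, hexp, smul_eq_mul,
      ← Real.exp_neg, ← Real.exp_add, ← Real.exp_add]
    ring_nf

theorem IsSubordinator.zero_mem_interior_integrableExpSet_tilted (hZ : IsSubordinator Q Z)
    (hlam : 0 ≤ lam) (hT : 0 ≤ T) (hg : Continuous g) (hθ : (θ : EReal) < kappaHat Q Z)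
    (a : ℝ) :
    0 ∈ interior (integrableExpSet (fun ω => a + integralDriver Z lam g T ω)
        (Q.tilted fun ω => θ * driver Z lam ω T)) := by
  rw [mem_interior_iff_mem_nhds]
  exact (hZ.eventually_mgf_tilted hlam hT hg hθ a).mono fun u hu => hu.1

/-- The shift `a` enters the cumulant generating function linearly and so affects only the first
cumulant; the normalising constant disappears because `i ≥ 1`. -/
theorem IsSubordinator.iteratedDeriv_cgf_tilted (hZ : IsSubordinator Q Z)
    (hlam : 0 ≤ lam) (hT : 0 ≤ T) (hg : Continuous g) (hθ : (θ : EReal) < kappaHat Q Z)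
    (a : ℝ) {i : ℕ} (hi : 1 ≤ i) :
    iteratedDeriv i (cgf (fun ω => a + integralDriver Z lam g T ω)
        (Q.tilted fun ω => θ * driver Z lam ω T)) 0 =
      (if i = 1 then a else 0) +
        lam * iteratedDeriv i (kappa Q Z) θ * ∫ s in (0 : ℝ)..T, g s ^ i := by
  set X := fun ω => a + integralDriver Z lam g T ω
  set ν := Q.tilted fun ω => θ * driver Z lam ω T
  set Φ := fun u : ℝ => ∫ s in (0 : ℝ)..T, kappa Q Z (θ + u * g s)
  have hcgf : cgf X ν =ᶠ[𝓝 0] fun u => -(lam * T * kappa Q Z θ) + (u * a + lam * Φ u) := by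
    filter_upwards [hZ.eventually_mgf_tilted hlam hT hg hθ a] with u hu
    rw [cgf, hu.2, Real.log_exp]
    ring
  have hlin : iteratedDeriv i (fun u : ℝ => u * a) 0 = if i = 1 then a else 0 := by
    rw [iteratedDeriv_mul_const_field]
    obtain ⟨j, rfl⟩ : ∃ j, i = j + 1 := ⟨i - 1, by omega⟩
    rw [iteratedDeriv_succ']
    simp [iteratedDeriv_const]
  -- Smoothness of the parameter integral is read off from analyticity of the cumulant generating
  -- function, from which it differs by an affine function.
  have han : ContDiffAt ℝ i (fun u => lam * Φ u) 0 := by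
    have h1 : ContDiffAt ℝ i
        (fun u => cgf X ν u + (lam * T * kappa Q Z θ - u * a)) 0 :=
      (analyticAt_cgf (hZ.zero_mem_interior_integrableExpSet_tilted hlam hT hg hθ
        a)).contDiffAt.add (by fun_prop)
    refine h1.congr_of_eventuallyEq ?_
    filter_upwards [hcgf] with u hu
    rw [hu]
    ring
  rw [(hcgf.iteratedDeriv i).eq_of_nhds, iteratedDeriv_const_add (by omega),
    iteratedDeriv_fun_add (by fun_prop) han, hlin, iteratedDeriv_const_mul_field,
    iteratedDeriv_integral_comp_add_mul (hZ.analyticAt_kappa hθ) hg hT, mul_assoc]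

/-- The recursion for the moments of `a + ∫_0^T g(s) dZ_{λ s}` under the measure
exponentially tilted by `θ Z_{λ T}`. -/
theorem IsSubordinator.tilted_moment_recursion (hZ : IsSubordinator Q Z)
    (hlam : 0 ≤ lam) (hT : 0 ≤ T) (hg : Continuous g) (hθ : (θ : EReal) < kappaHat Q Z)
    (a : ℝ) {H : ℕ → ℝ} (hH : ∀ k, H k = ∫ ω, (a + integralDriver Z lam g T ω) ^ k
      ∂(Q.tilted fun ω => θ * driver Z lam ω T)) {h : ℕ} (hh : 1 ≤ h) :
    H h = a * H (h - 1) + lam * ∑ i ∈ Finset.Icc 1 h, ((h - 1).choose (i - 1) : ℝ) * H (h - i) *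
      iteratedDeriv i (kappa Q Z) θ * ∫ s in (0 : ℝ)..T, g s ^ i := by
  have := isProbabilityMeasure_tilted (hZ.integrable_exp_mul_driver hθ lam T)
  rw [hH h, integral_pow_eq_sum_cumulants
    (hZ.zero_mem_interior_integrableExpSet_tilted hlam hT hg hθ a) hh]
  -- The term `a H (h - 1)` is the contribution of `a` to the first cumulant, hence to the summand
  -- `i = 1`.
  have hsplit : a * H (h - 1) = ∑ i ∈ Finset.Icc 1 h,
      ((h - 1).choose (i - 1) : ℝ) * H (h - i) * (if i = 1 then a else 0) := by
    rw [Finset.sum_eq_single_of_mem 1 (Finset.mem_Icc.2 ⟨le_rfl, hh⟩)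
      fun i _ hi => by rw [if_neg hi, mul_zero]]
    simp [mul_comm]
  rw [hsplit, Finset.mul_sum, ← Finset.sum_add_distrib]
  refine Finset.sum_congr rfl fun i hi => ?_
  rw [hZ.iteratedDeriv_cgf_tilted hlam hT hg hθ a (Finset.mem_Icc.1 hi).1, ← hH]
  ring

/-- Exponential moments near `0` under the tilted measure give moments of every order there; undoing
the tilt restores the weight `P_T^l` up to a constant. -/
theorem IsSubordinator.integrable_P_pow_mul (hZ : IsSubordinator Q Z)
    (hlam : 0 ≤ lam) (hT : 0 ≤ T) (hg : Continuous g) {rho : ℝ} {l : ℕ}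
    (hθ : ((l * rho : ℝ) : EReal) < kappaHat Q Z) (a : ℝ) (k : ℕ) :
    Integrable (fun ω => P Q Z lam rho T ω ^ l * (a + integralDriver Z lam g T ω) ^ k) Q := by
  have := integrable_pow_of_mem_interior_integrableExpSet
    (hZ.zero_mem_interior_integrableExpSet_tilted hlam hT hg hθ a) k
  have := (integrable_tilted_iff (hZ.integrable_exp_mul_driver hθ lam T) _).1 this
  refine (this.const_mul (Real.exp (-(l * (lam * T * kappa Q Z rho))))).congr
    (.of_forall fun ω => ?_)
  simp only [P_pow, smul_eq_mul, mul_assoc]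

theorem IsSubordinator.integral_P_pow_mul (hZ : IsSubordinator Q Z)
    (hlam : 0 ≤ lam) (hT : 0 ≤ T) {rho : ℝ} {l : ℕ}
    (hθ : ((l * rho : ℝ) : EReal) < kappaHat Q Z) (X : Ω → ℝ) :
    ∫ ω, P Q Z lam rho T ω ^ l * X ω ∂Q =
      Real.exp (lam * T * (kappa Q Z (l * rho) - l * kappa Q Z rho)) *
        ∫ ω, X ω ∂(Q.tilted fun ω => l * rho * driver Z lam ω T) := by
  rw [integral_tilted]
  simp_rw [div_eq_inv_mul, mul_smul, P_pow, mul_assoc (Real.exp _)]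
  rw [integral_smul, hZ.integral_exp_mul_driver hlam hT hθ, integral_const_mul, ← Real.exp_neg]
  simp only [smul_eq_mul]
  rw [← mul_assoc (Real.exp _), ← Real.exp_add]
  ring_nf

end TiltedMoments

/-! ### Pathwise solution of the variance equation -/

theorem continuous_alpha (lam t : ℝ) : Continuous fun s => alpha lam s t := by
  unfold alpha
  fun_prop

/-- Integration by parts: `∫_0^T e^{λ t} (z(t) - z(0)) dt = ∫_0^T ∫_s^T e^{λ t} dt dz(s)`. -/
theorem integral_exp_mul_path {z : ℝ → ℝ} (hz : Monotone z)
    (hr : ∀ x, ContinuousWithinAt z (Ici x) x) (h0 : z 0 = 0) {lam T : ℝ} (hlam : 0 < lam)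
    (hT : 0 ≤ T) :
    ∫ t in (0 : ℝ)..T, Real.exp (lam * t) * z t =
      Real.exp (lam * T) * ∫ s in Ioc 0 T, alpha lam s T ∂(pathMeasure z) := by
  set μ := pathMeasure z
  -- Since `z(t)` is the mass of `(0, t]`, the left side is a double integral over the triangle `s ≤
  -- t`, and Fubini applies.
  set f : ℝ → ℝ → ℝ := fun t s => if s ≤ t then Real.exp (lam * t) else 0 with hf
  have hmeas : Measurable (Function.uncurry f) :=
    Measurable.ite (measurableSet_le measurable_snd measurable_fst) (by fun_prop)
      measurable_const
  have : IsFiniteMeasure (μ.restrict (Ioc 0 T)) :=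
    isFiniteMeasure_restrict.2 measure_Ioc_lt_top.ne
  have hint : Integrable (Function.uncurry f)
      ((volume.restrict (Ioc 0 T)).prod (μ.restrict (Ioc 0 T))) := by
    refine Integrable.of_bound hmeas.aestronglyMeasurable (Real.exp (lam * T)) ?_
    rw [Measure.prod_restrict]
    refine ae_restrict_of_forall_mem (measurableSet_Ioc.prod measurableSet_Ioc) fun p hp => ?_
    simp only [Function.uncurry, hf]
    split_ifs
    · rw [Real.norm_eq_abs, Real.abs_exp, Real.exp_le_exp]
      exact mul_le_mul_of_nonneg_left hp.1.2 hlam.le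
    · simpa using (Real.exp_pos _).le
  have hL : ∫ t in (0 : ℝ)..T, Real.exp (lam * t) * z t =
      ∫ t in Ioc 0 T, ∫ s in Ioc 0 T, f t s ∂μ := by
    rw [intervalIntegral.integral_of_le hT]
    refine setIntegral_congr_fun measurableSet_Ioc fun t ht => ?_
    have e : f t = (Iic t).indicator fun _ => Real.exp (lam * t) := by
      ext s; simp [hf, indicator]
    rw [e, setIntegral_indicator measurableSet_Iic, Ioc_inter_Iic, min_eq_right ht.2,
      setIntegral_const, pathMeasure_real_Ioc hz hr ht.1.le, h0, sub_zero, smul_eq_mul, mul_comm]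
  rw [hL, integral_integral_swap hint, ← integral_const_mul]
  refine setIntegral_congr_fun measurableSet_Ioc fun s hs => ?_
  have e : (fun t => f t s) = (Ici s).indicator fun t => Real.exp (lam * t) := by
    ext t; simp [hf, indicator]
  rw [e, setIntegral_indicator measurableSet_Ici]
  have hset : Ioc 0 T ∩ Ici s = Icc s T := by
    ext x
    simp only [mem_inter_iff, mem_Ioc, mem_Ici, mem_Icc]
    exact ⟨fun h => ⟨h.2, h.1.2⟩, fun h => ⟨⟨hs.1.trans_le h.1, h.2⟩, h.1⟩⟩
  rw [hset, integral_Icc_eq_integral_Ioc, ← intervalIntegral.integral_of_le hs.2]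
  have hd : ∀ x ∈ uIcc s T, HasDerivAt (fun t => Real.exp (lam * t) / lam)
      (Real.exp (lam * x)) x := fun x _ => by
    have := (((hasDerivAt_id x).const_mul lam).exp).div_const lam
    simpa [hlam.ne'] using this
  rw [intervalIntegral.integral_eq_sub_of_hasDerivAt hd
    (Continuous.intervalIntegrable (by fun_prop) _ _), alpha]
  have : Real.exp (lam * s) = Real.exp (lam * T) * Real.exp (-lam * (T - s)) := by
    rw [← Real.exp_add]; ring_nf
  rw [this]
  ring

/-- The pathwise solution of `σ_t = v - λ ∫_0^t σ_s ds + z(t)`, integrated over `[0, T]`. -/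
theorem integral_eq_of_variance_equation {z σ : ℝ → ℝ} {lam v T : ℝ} (hlam : 0 < lam)
    (hT : 0 ≤ T) (hz : Monotone z) (hr : ∀ x, ContinuousWithinAt z (Ici x) x) (h0 : z 0 = 0)
    (hint : ∀ t, 0 ≤ t → IntervalIntegrable σ volume 0 t)
    (hσ : ∀ t, 0 ≤ t → σ t = v - lam * (∫ s in (0 : ℝ)..t, σ s) + z t) :
    ∫ s in (0 : ℝ)..T, σ s =
      v * alpha lam 0 T + ∫ s in Ioc 0 T, alpha lam s T ∂(pathMeasure z) := by
  set I : ℝ → ℝ := fun t => ∫ s in (0 : ℝ)..t, σ s with hI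
  have hIcont (b : ℝ) (hb : 0 ≤ b) : ContinuousOn I (uIcc 0 b) := by
    refine intervalIntegral.continuousOn_primitive_interval ?_
    rw [uIcc_of_le hb, integrableOn_Icc_iff_integrableOn_Ioc]
    exact (intervalIntegrable_iff_integrableOn_Ioc_of_le hb).1 (hint b hb)
  -- Since `z` may jump, `σ` is only known to be right-continuous; a right derivative of `I`
  -- suffices for the fundamental theorem used below.
  have hIder : ∀ x ∈ Ioo 0 T, HasDerivWithinAt I (σ x) (Ioi x) x := by
    intro x hx
    have hIx : ContinuousAt I x :=
      (hIcont T hT).continuousAt (by rw [uIcc_of_le hT]; exact Icc_mem_nhds hx.1 hx.2)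
    have hcont : ContinuousWithinAt σ (Ioi x) x := by
      have h1 : ContinuousWithinAt (fun t => v - lam * I t + z t) (Ioi x) x :=
        (continuousAt_const.sub (hIx.const_mul lam)).continuousWithinAt.add
          ((hr x).mono Ioi_subset_Ici_self)
      exact h1.congr (fun t ht => hσ t (hx.1.trans ht).le) (hσ x hx.1.le)
    have hmeas : StronglyMeasurableAtFilter σ (𝓝[>] x) volume :=
      ⟨Ioc 0 T, mem_of_superset (Ioo_mem_nhdsGT hx.2)
        fun y hy => ⟨hx.1.trans hy.1, hy.2.le⟩,
        ((intervalIntegrable_iff_integrableOn_Ioc_of_le hT).1 (hint T hT)).aestronglyMeasurable⟩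
    exact (intervalIntegral.integral_hasDerivWithinAt_right (hint x hx.1.le) hmeas
      hcont (s := Ici x)).mono Ioi_subset_Ici_self
  have hzi : IntervalIntegrable (fun t => Real.exp (lam * t) * z t) volume 0 T :=
    hz.intervalIntegrable.continuousOn_mul (by fun_prop)
  have hei : IntervalIntegrable (fun t => v * Real.exp (lam * t)) volume 0 T :=
    Continuous.intervalIntegrable (by fun_prop) _ _
  have hexpd (x : ℝ) : HasDerivAt (fun t => Real.exp (lam * t)) (lam * Real.exp (lam * x)) x := by
    simpa [mul_comm] using ((hasDerivAt_id x).const_mul lam).exp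
  -- Integrating factor: the right derivative of `e^{λ t} I(t)` is `e^{λ t} (λ I + σ) = e^{λ t} (v +
  -- z)`.
  have hkey : ∫ t in (0 : ℝ)..T, (v * Real.exp (lam * t) + Real.exp (lam * t) * z t) =
      Real.exp (lam * T) * I T := by
    rw [intervalIntegral.integral_eq_sub_of_hasDeriv_right
      (f := fun t => Real.exp (lam * t) * I t) ?_ ?_ (hei.add hzi)]
    · simp [hI]
    · exact ContinuousOn.mul (by fun_prop) (hIcont T hT)
    · intro x hx
      rw [min_eq_left hT, max_eq_right hT] at hx
      have h1 := (hexpd x).hasDerivWithinAt.mul (hIder x hx)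
      convert! h1 using 1
      rw [hσ x hx.1.le]
      ring
  have hd : ∀ x ∈ uIcc 0 T, HasDerivAt (fun t => v * (Real.exp (lam * t) / lam))
      (v * Real.exp (lam * x)) x := fun x _ => by
    have := ((hexpd x).div_const lam).const_mul v
    rwa [mul_div_cancel_left₀ _ hlam.ne'] at this
  rw [intervalIntegral.integral_add hei hzi, integral_exp_mul_path hz hr h0 hlam hT,
    intervalIntegral.integral_eq_sub_of_hasDerivAt hd hei] at hkey
  have hexp := Real.exp_pos (lam * T)
  have ha : v * alpha lam 0 T * Real.exp (lam * T) =
      v * (Real.exp (lam * T) / lam) - v * (Real.exp (lam * 0) / lam) := by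
    have : Real.exp (-lam * (T - 0)) * Real.exp (lam * T) = 1 := by
      rw [← Real.exp_add]; simp
    rw [alpha, mul_zero, Real.exp_zero]
    linear_combination -(v / lam) * this
  refine mul_left_cancel₀ hexp.ne' ?_
  change Real.exp (lam * T) * I T = _
  linear_combination -hkey - ha

/-- The closed form of `∫_0^T α_{s,T}^i ds`. -/
theorem integral_alpha_pow {lam : ℝ} (hlam : lam ≠ 0) (T : ℝ) (i : ℕ) :
    ∫ s in (0 : ℝ)..T, alpha lam s T ^ i = 1 / lam ^ i * (T + ∑ j ∈ Finset.Icc 1 i,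
      1 / (j : ℝ) * (i.choose j : ℝ) * (-1) ^ j * alpha lam 0 (j * T)) := by
  have hexpand (s : ℝ) : alpha lam s T ^ i = ∑ j ∈ Finset.range (i + 1),
      1 / lam ^ i * ((-1) ^ j * (i.choose j : ℝ)) * Real.exp (-lam * j * (T - s)) := by
    rw [alpha, mul_pow, one_div_pow, sub_eq_neg_add, add_pow, Finset.mul_sum]
    refine Finset.sum_congr rfl fun j _ => ?_
    rw [neg_pow, ← Real.exp_nat_mul, one_pow]
    ring_nf
  have hone (j : ℕ) (hj : j ≠ 0) :
      ∫ s in (0 : ℝ)..T, Real.exp (-lam * j * (T - s)) = 1 / j * alpha lam 0 (j * T) := by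
    have hj' : (j : ℝ) ≠ 0 := Nat.cast_ne_zero.2 hj
    have hd : ∀ x ∈ uIcc 0 T, HasDerivAt (fun s => Real.exp (-lam * j * (T - s)) / (lam * j))
        (Real.exp (-lam * j * (T - x))) x := fun x _ => by
      have := ((((hasDerivAt_id x).const_sub T).const_mul (-lam * j)).exp).div_const (lam * j)
      convert! this using 1
      simp only [id]
      field_simp
    rw [intervalIntegral.integral_eq_sub_of_hasDerivAt hd
      (Continuous.intervalIntegrable (by fun_prop) _ _), alpha]
    simp only [sub_self, mul_zero, Real.exp_zero, sub_zero]
    rw [mul_assoc]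
    field_simp
  simp_rw [hexpand]
  rw [intervalIntegral.integral_finsetSum fun j _ =>
    Continuous.intervalIntegrable (by fun_prop) _ _]
  simp_rw [intervalIntegral.integral_const_mul]
  -- The binomial term `j = 0` is split off: it integrates to `T`, while each `j ≥ 1` yields
  -- `α_{0,jT} / j`.
  rw [Finset.sum_range_succ', mul_add, Finset.mul_sum, ← Finset.Ico_add_one_right_eq_Icc,
    Finset.sum_Ico_eq_sum_range, add_comm]
  congr 1
  · simp
  · refine Finset.sum_congr (by simp) fun j _ => ?_
    rw [hone _ j.succ_ne_zero, add_comm 1 j]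
    ring

section Variance

variable {Ω : Type*} [MeasurableSpace Ω] {Q : Measure Ω} {Z : ℝ≥0 → Ω → ℝ}
  {sigmaSq : ℝ≥0 → Ω → ℝ} {lam T v0 : ℝ}

/-- The integrated variance is an affine functional of the driving subordinator. -/
theorem IsSubordinator.ae_integratedVariance_eq (hZ : IsSubordinator Q Z) (hlam : 0 < lam)
    (hT : 0 ≤ T) (hsigma : IsVarianceProcess Q Z lam v0 sigmaSq) :
    ∀ᵐ ω ∂Q, integratedVariance sigmaSq T ω =
      v0 * alpha lam 0 T + integralDriver Z lam (fun s => alpha lam s T) T ω := by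
  filter_upwards [hZ.ae_driver hlam.le, hsigma] with ω ⟨hm, hr, h0⟩ hω
  refine integral_eq_of_variance_equation (σ := fun s => sigmaSq s.toNNReal ω) hlam hT hm hr h0
    (fun t ht => ?_) fun t ht => ?_
  · simpa [ht] using (hω t.toNNReal).1
  · simpa [ht, integratedVariance] using (hω t.toNNReal).2

theorem IsSubordinator.integrable_and_integral_integratedVariance [IsProbabilityMeasure Q]
    (hZ : IsSubordinator Q Z) (hkappa : 0 < kappaHat Q Z) (hlam : 0 < lam)
    (hT : 0 ≤ T) (hsigma : IsVarianceProcess Q Z lam v0 sigmaSq) :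
    Integrable (integratedVariance sigmaSq T) Q ∧
    ∫ ω, integratedVariance sigmaSq T ω ∂Q = v0 * alpha lam 0 T +
      lam * deriv (kappa Q Z) 0 * ∫ s in (0 : ℝ)..T, alpha lam s T := by
  have hae := hZ.ae_integratedVariance_eq hlam hT hsigma
  have hg := continuous_alpha lam T
  have h0 : ((0 : ℝ) : EReal) < kappaHat Q Z := by simpa using hkappa
  have hmem := hZ.zero_mem_interior_integrableExpSet_tilted hlam.le hT hg h0 (v0 * alpha lam 0 T)
  have hcgf := hZ.iteratedDeriv_cgf_tilted hlam.le hT hg h0 (v0 * alpha lam 0 T) le_rfl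
  -- At `θ = 0` the tilt is trivial, so the first cumulant is the mean under `Q`.
  simp only [zero_mul, tilted_const, iteratedDeriv_one, if_true, pow_one] at hmem hcgf
  refine ⟨(integrable_of_mem_interior_integrableExpSet hmem).congr
    (hae.mono fun ω h => h.symm), ?_⟩
  rw [integral_congr_ae hae, ← hcgf, deriv_cgf_zero hmem]
  simp

end Variance

end BNS

/-! ### The moment formulas -/

theorem mainTheorem2 {Ω : Type*} [MeasurableSpace Ω] (Q : Measure Ω) [IsProbabilityMeasure Q]
    (Z : ℝ≥0 → Ω → ℝ) (hZ : BNS.IsSubordinator Q Z)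
    (lam T rho v0 : ℝ) (hlam : 0 < lam) (hT : 0 < T) (hv0 : 0 < v0)
    (hkappa : 0 < BNS.kappaHat Q Z) (hrho : (rho : EReal) < BNS.kappaHat Q Z)
    (sigmaSq : ℝ≥0 → Ω → ℝ) (hsigma : BNS.IsVarianceProcess Q Z lam v0 sigmaSq) :
    -- moments of `P` and `F`
    (∀ (f : ℝ → ℝ) (c d : ℝ), ContinuousOn f (Ici 0) → 0 ≤ c → 0 ≤ d → 0 < max c d →
      ∃ H : ℕ → ℕ → ℝ, ∀ l : ℕ, ((l * rho : ℝ) : EReal) < BNS.kappaHat Q Z →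
        H l 0 = 1 ∧
        ∀ k : ℕ, BNS.ContDiffNearZero k (BNS.kappa Q Z) →
          Integrable (fun ω => BNS.P Q Z lam rho T ω ^ l * BNS.F Z lam f c d T ω ^ k) Q ∧
          ∫ ω, BNS.P Q Z lam rho T ω ^ l * BNS.F Z lam f c d T ω ^ k ∂Q =
            Real.exp (lam * T * (BNS.kappa Q Z (l * rho) - l * BNS.kappa Q Z rho)) * H l k ∧
          ∀ h ∈ Finset.Icc 1 k,
            H l h = f T * H l (h - 1) +
              lam * ∑ i ∈ Finset.Icc 1 h, ((h - 1).choose (i - 1) : ℝ) * H l (h - i) *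
                iteratedDeriv i (BNS.kappa Q Z) (l * rho) *
                ∫ s in (0 : ℝ)..T, (c * BNS.alpha lam s T + d) ^ i) ∧
    -- moments of `P` and the centred integrated variance
    Integrable (BNS.integratedVariance sigmaSq T) Q ∧
    (∃ H : ℕ → ℕ → ℝ, ∀ l : ℕ, ((l * rho : ℝ) : EReal) < BNS.kappaHat Q Z →
        H l 0 = 1 ∧
        ∀ k : ℕ, BNS.ContDiffNearZero k (BNS.kappa Q Z) →
          Integrable (fun ω => BNS.P Q Z lam rho T ω ^ l *
            (BNS.integratedVariance sigmaSq T ω -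
              ∫ ω', BNS.integratedVariance sigmaSq T ω' ∂Q) ^ k) Q ∧
          ∫ ω, BNS.P Q Z lam rho T ω ^ l *
            (BNS.integratedVariance sigmaSq T ω -
              ∫ ω', BNS.integratedVariance sigmaSq T ω' ∂Q) ^ k ∂Q =
            Real.exp (lam * T * (BNS.kappa Q Z (l * rho) - l * BNS.kappa Q Z rho)) * H l k ∧
          ∀ h ∈ Finset.Icc 1 k,
            H l h =
              (-lam * deriv (BNS.kappa Q Z) 0 * ∫ s in (0 : ℝ)..T, BNS.alpha lam s T) *
                H l (h - 1) +
              lam * ∑ i ∈ Finset.Icc 1 h, ((h - 1).choose (i - 1) : ℝ) * H l (h - i) *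
                iteratedDeriv i (BNS.kappa Q Z) (l * rho) *
                (∫ s in (0 : ℝ)..T, BNS.alpha lam s T ^ i) ∧
            H l h =
              deriv (BNS.kappa Q Z) 0 * (BNS.alpha lam 0 T - T) * H l (h - 1) +
              ∑ i ∈ Finset.Icc 1 h, 1 / lam ^ (i - 1) * ((h - 1).choose (i - 1) : ℝ) *
                H l (h - i) * iteratedDeriv i (BNS.kappa Q Z) (l * rho) *
                (T + ∑ j ∈ Finset.Icc 1 i,
                  1 / (j : ℝ) * (i.choose j : ℝ) * (-1) ^ j * BNS.alpha lam 0 (j * T))) := by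
  have hT0 := hT.le
  have hl0 := hlam.le
  refine ⟨fun f c d _ _ _ _ => ?_, ?_⟩
  · have hg : Continuous fun s => c * BNS.alpha lam s T + d :=
      ((BNS.continuous_alpha lam T).const_mul c).add_const d
    refine ⟨fun l h => ∫ ω, BNS.F Z lam f c d T ω ^ h
      ∂(Q.tilted fun ω => l * rho * BNS.driver Z lam ω T), fun l hl => ⟨?_, fun k _ => ⟨?_, ?_, ?_⟩⟩⟩
    · have := isProbabilityMeasure_tilted (hZ.integrable_exp_mul_driver hl lam T)
      simp
    · exact hZ.integrable_P_pow_mul hl0 hT0 hg hl (f T) k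
    · exact hZ.integral_P_pow_mul hl0 hT0 hl _
    · exact fun h hh => hZ.tilted_moment_recursion hl0 hT0 hg hl (f T) (fun _ => rfl)
        (Finset.mem_Icc.1 hh).1
  · obtain ⟨hint, hmean⟩ :=
      hZ.integrable_and_integral_integratedVariance hkappa hlam hT0 hsigma
    have hg := BNS.continuous_alpha lam T
    -- Subtracting the mean cancels `v0 * alpha lam 0 T` and leaves this constant as the shift.
    set a := -lam * deriv (BNS.kappa Q Z) 0 * ∫ s in (0 : ℝ)..T, BNS.alpha lam s T with ha
    have hae : ∀ᵐ ω ∂Q, BNS.integratedVariance sigmaSq T ω -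
        ∫ ω', BNS.integratedVariance sigmaSq T ω' ∂Q =
        a + BNS.integralDriver Z lam (fun s => BNS.alpha lam s T) T ω := by
      filter_upwards [hZ.ae_integratedVariance_eq hlam hT0 hsigma] with ω h
      rw [h, hmean, ha]
      ring
    have haeP (l k : ℕ) : (fun ω => BNS.P Q Z lam rho T ω ^ l *
        (a + BNS.integralDriver Z lam (fun s => BNS.alpha lam s T) T ω) ^ k) =ᵐ[Q]
        fun ω => BNS.P Q Z lam rho T ω ^ l * (BNS.integratedVariance sigmaSq T ω -
          ∫ ω', BNS.integratedVariance sigmaSq T ω' ∂Q) ^ k := by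
      filter_upwards [hae] with ω h
      rw [h]
    refine ⟨hint, fun l h => ∫ ω,
      (a + BNS.integralDriver Z lam (fun s => BNS.alpha lam s T) T ω) ^ h
      ∂(Q.tilted fun ω => l * rho * BNS.driver Z lam ω T), fun l hl => ⟨?_, fun k _ => ⟨?_, ?_, ?_⟩⟩⟩
    · have := isProbabilityMeasure_tilted (hZ.integrable_exp_mul_driver hl lam T)
      simp
    · exact (hZ.integrable_P_pow_mul hl0 hT0 hg hl a k).congr (haeP l k)
    · rw [← integral_congr_ae (haeP l k)]
      exact hZ.integral_P_pow_mul hl0 hT0 hl _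
    · intro h hh
      have hrec := hZ.tilted_moment_recursion hl0 hT0 hg hl a (fun _ => rfl)
        (Finset.mem_Icc.1 hh).1
      refine ⟨hrec, hrec.trans ?_⟩
      -- The two forms of the recursion agree term by term through the closed form of `∫ α^i`; the
      -- case `i = 1`, `∫ α = (T - α_{0,T}) / λ`, rewrites the shift.
      congr 2
      · have := BNS.integral_alpha_pow hlam.ne' T 1
        simp only [pow_one, Finset.Icc_self, Finset.sum_singleton, Nat.cast_one, div_one,
          Nat.choose_self, one_mul, mul_neg, mul_one, neg_mul] at this
        rw [ha, this]
        field_simp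
        ring
      · rw [Finset.mul_sum]
        refine Finset.sum_congr rfl fun i hi => ?_
        rw [BNS.integral_alpha_pow hlam.ne' T i]
        -- Writing `i = j + 1` removes the truncated subtraction; the outer `λ` then cancels one
        -- power in `1 / λ^i`.
        obtain ⟨j, rfl⟩ : ∃ j, i = j + 1 := ⟨i - 1, by have := (Finset.mem_Icc.1 hi).1; omega⟩
        rw [Nat.add_sub_cancel, pow_succ lam j]
        field_simp
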